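/- Let $n,d\ge 1$, let $m_1,\dots,m_n>0$, and let $\mathcal M(q_1,\dots,q_n)=(m_1q_1,\dots,m_nq_n)$ on $(\mathbb R^d)^n$, with the inner product $\langle q,q'\rangle_{\mathcal M}=\sum_i m_i\langle q_i,q_i'\rangle$. Let $M=\{q\in(\mathbb R^d)^n \mid \sum_i m_iq_i=0\}$ be the center of mass configuration space. Covectors on a submanifold $Z\subseteq M$ are identified by means of $\langle\cdot,\cdot\rangle_{\mathcal M}$ with momentum vectors: $T^*Z=\{(p,q)\mid q\in Z,\ \mathcal M^{-1}p\in T_qZ\}$, where $p$ acts on $v\in T_qZ$ by $\sum_i\langle p_i,v_i\rangle$. The canonical symplectic form of $T^*Z$ is $-d\theta$ with the tautological one-form $\theta=\sum_i\langle p_i, dq_i\rangle$. Let $\mathcal C$ be a set partition of $\{1,\dots,n\}$ other than the partition into singletons. For a particle $i$ let $[i]$ be its atom in $\mathcal C$ and put $m_{[i]}=\sum_{j\in[i]}m_j$. Put $$(q^E)_i=\tfrac1{m_{[i]}}\sum_{j\in[i]}m_jq_j,\quad q^I=q-q^E,\qquad (p^E)_i=\tfrac{m_i}{m_{[i]}}\sum_{j\in[i]}p_j,\quad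 p^I=p-p^E,$$ and $K^E(p)=\sum_i \frac{\|(p^E)_i\|^2}{2m_i}$. Let $\Delta^E_{\mathcal C}=\{q\in M\mid q_i=q_j \text{ if } [i]=[j]\}$, $\Delta^I_{\mathcal C}=\{q\in M\mid q^E=0\}$, $\mathbb S^I_{\mathcal C}=\{q\in\Delta^I_{\mathcal C}\mid \langle q,q\rangle_{\mathcal M}=1\}$, and $Z_{\mathcal C}=\mathbb S^I_{\mathcal C}\times\Delta^E_{\mathcal C}\subseteq \Delta^I_{\mathcal C}\oplus\Delta^E_{\mathcal C}=M$. Let $P_{\mathcal C}=T^*Z_{\mathcal C}$ with its canonical symplectic form $\omega_{\mathcal C}$, and on $P_{\mathcal C}\times P_{\mathcal C}$ let $\omega_\ominus=\pi_-^*\omega_{\mathcal C}-\pi_+^*\omega_{\mathcal C}$, where $\pi_-$ is the projection to the left factor and $\pi_+$ the projection to the right factor. **Lemma (Lagrangian relation).** For all $E_-,E_+>0$ the set $L_{\mathcal C;E_-,E_+}$ of all $(p_-,q_-;p_+,q_+)\in P_{\mathcal C}\times P_{\mathcal C}$ with $$(p_\pm)^I=0,\qquad (p_+)^E=(p_-)^E,\qquad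 K^E(p_\pm)<\min(E_-,E_+),$$ $$(q_+)^E-\frac{(\mathcal M^{-1}p_+)^E}{\sqrt{2(E_+-K^E(p_+))}}=(q_-)^E+\frac{(\mathcal M^{-1}p_-)^E}{\sqrt{2(E_--K^E(p_-))}}$$ is a Lagrangian submanifold of the symplectic manifold $(P_{\mathcal C}\times P_{\mathcal C},\omega_\ominus)$, that is, an embedded submanifold of half the dimension on which $\omega_\ominus$ vanishes. -/

import Mathlib

open scoped ContDiff

noncomputable section

namespace ClusterScattering

/-! ## Embedded submanifolds, symplectic and Lagrangian submanifolds -/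

section Submanifolds

variable {E : Type*} [NormedAddCommGroup E] [NormedSpace ℝ E]

/-- `S` is a smooth embedded submanifold of dimension `k` (without boundary) of the
finite-dimensional vector space `E`: near each of its points, `S` is the zero set of a smooth
map to `ℝ ^ c`, `c` being the codimension, whose derivative at the point is onto. -/
def IsEmbeddedSubmanifold (k : ℕ) (S : Set E) : Prop :=
  ∃ c : ℕ, k + c = Module.finrank ℝ E ∧
    ∀ x ∈ S, ∃ (U : Set E) (f : E → (Fin c → ℝ)), IsOpen U ∧ x ∈ U ∧
      ContDiffOn ℝ ∞ f U ∧ S ∩ U = {y ∈ U | f y = 0} ∧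
      Function.Surjective (fderiv ℝ f x)

/-- The tangent space `T_x S`: velocities at `x` of smooth curves in `S` through `x`. -/
def tangentSpaceAt (S : Set E) (x : E) : Set E :=
  {v | ∃ γ : ℝ → E, ContDiffAt ℝ ∞ γ 0 ∧ γ 0 = x ∧ (∀ᶠ t in nhds 0, γ t ∈ S) ∧
    HasDerivAt γ v 0}

/-- The constant (hence closed) two-form `Ω` on `E` restricts to a symplectic form on the
embedded submanifold `X`. -/
structure IsSymplecticSubmanifold (Ω : LinearMap.BilinForm ℝ E) (X : Set E) : Prop where
  alt : Ω.IsAlt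
  submanifold : ∃ k : ℕ, IsEmbeddedSubmanifold k X
  nondegenerate : ∀ x ∈ X, ∀ u ∈ tangentSpaceAt X x,
    (∀ v ∈ tangentSpaceAt X x, Ω u v = 0) → u = 0

/-- `L` is a Lagrangian submanifold of the symplectic manifold `(X, Ω|_X)`: an embedded
submanifold of half the dimension of `X` on which `Ω` vanishes. -/
structure IsLagrangianSubmanifold (Ω : LinearMap.BilinForm ℝ E) (X L : Set E) : Prop where
  symplectic : IsSymplecticSubmanifold Ω X
  subset : L ⊆ X
  half_dim : ∃ k : ℕ, IsEmbeddedSubmanifold (2 * k) X ∧ IsEmbeddedSubmanifold k L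
  isotropic : ∀ x ∈ L, ∀ u ∈ tangentSpaceAt L x, ∀ v ∈ tangentSpaceAt L x, Ω u v = 0

end Submanifolds

/-! ## Configurations, momenta and the mass matrix -/

/-- The space `ℝ ^ (n d)` of vectors `(q₁, …, qₙ)` with `qᵢ ∈ ℝ ^ d`; used for positions and for
momentum vectors. -/
abbrev Vec (d n : ℕ) : Type := Fin n → EuclideanSpace ℝ (Fin d)

/-- Pairs `(p, q)` of a momentum vector and a position. -/
abbrev Phase (d n : ℕ) : Type := Vec d n × Vec d n

variable {d n : ℕ}

/-- The pairing `⟨p, v⟩ = ∑ᵢ ⟨pᵢ, vᵢ⟩` of momenta and velocities. -/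
def pairing : LinearMap.BilinForm ℝ (Vec d n) :=
  LinearMap.mk₂ ℝ (fun p v => ∑ i, inner ℝ (p i) (v i))
    (by intro p p' v; simp [inner_add_left, Finset.sum_add_distrib])
    (by intro c p v; simp [real_inner_smul_left, Finset.mul_sum])
    (by intro p v v'; simp [inner_add_right, Finset.sum_add_distrib])
    (by intro c p v; simp [real_inner_smul_right, Finset.mul_sum])

/-- Multiplication by the mass matrix, `v ↦ (mᵢ vᵢ)ᵢ`. -/
def massMul (m : Fin n → ℝ) (v : Vec d n) : Vec d n := fun i => m i • v i

/-- Multiplication by the inverse of the mass matrix, `p ↦ (pᵢ / mᵢ)ᵢ`. -/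
def massInv (m : Fin n → ℝ) (p : Vec d n) : Vec d n := fun i => (m i)⁻¹ • p i

/-- The inner product `⟨q, q'⟩_𝓜 = ∑ᵢ mᵢ ⟨qᵢ, q'ᵢ⟩`. -/
def massInner (m : Fin n → ℝ) (q q' : Vec d n) : ℝ := pairing q (massMul m q')

/-- The center of mass configuration space `M`. -/
def centerOfMass (m : Fin n → ℝ) : Set (Vec d n) := {q | ∑ i, m i • q i = 0}

/-- The kinetic energy `K(p) = ∑ᵢ ⟨pᵢ, pᵢ⟩ / (2 mᵢ)`. -/
def kinetic (m : Fin n → ℝ) (p : Vec d n) : ℝ := ∑ i, inner ℝ (p i) (p i) / (2 * m i)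

/-! ## Cotangent bundles -/

/-- The cotangent bundle `T*Z` of a submanifold `Z` of configuration space. By means of the inner
product `⟨·,·⟩_𝓜`, a covector on `T_q Z` is represented by the unique momentum vector `p` in
`𝓜 (T_q Z)` such that `v ↦ ⟨p, v⟩` is that covector. -/
def cotangentBundle (m : Fin n → ℝ) (Z : Set (Vec d n)) : Set (Phase d n) :=
  {x | x.2 ∈ Z ∧ massInv m x.1 ∈ tangentSpaceAt Z x.2}

/-- The representation of covectors used in `cotangentBundle`. -/
theorem existsUnique_covector (m : Fin n → ℝ) (hm : ∀ i, 0 < m i)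
    (W : Submodule ℝ (Vec d n)) (φ : Module.Dual ℝ W) :
    ∃! p : Vec d n, massInv m p ∈ W ∧ ∀ w : W, pairing p (w : Vec d n) = φ w := by
  have hinv : ∀ v : Vec d n, massInv m (massMul m v) = v := by
    intro v; funext i; simp [massInv, massMul, smul_smul, (hm i).ne']
  have hmul : ∀ p : Vec d n, massMul m (massInv m p) = p := by
    intro v; funext i; simp [massInv, massMul, smul_smul, (hm i).ne']
  let T : W →ₗ[ℝ] Module.Dual ℝ W :=
    { toFun := fun v => (pairing (massMul m (v : Vec d n))).domRestrict W
      map_add' := by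
        intro v w; ext u
        have : massMul m ((v : Vec d n) + (w : Vec d n)) =
            massMul m (v : Vec d n) + massMul m (w : Vec d n) := by
          funext i; simp [massMul]
        simp [this]
      map_smul' := by
        intro c v; ext u
        have : massMul m (c • (v : Vec d n)) = c • massMul m (v : Vec d n) := by
          funext i; simp [massMul, smul_comm c]
        simp [this] }
  have hT : Function.Injective T := by
    rw [← LinearMap.ker_eq_bot, LinearMap.ker_eq_bot']
    intro v hv
    have h0 : ∑ i, m i * inner ℝ ((v : Vec d n) i) ((v : Vec d n) i) = 0 := by
      have := congrArg (fun g : Module.Dual ℝ W => g v) hv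
      simpa [T, pairing, massMul, real_inner_smul_left] using this
    have h1 := (Finset.sum_eq_zero_iff_of_nonneg
      (fun i _ => mul_nonneg (hm i).le real_inner_self_nonneg)).1 h0
    ext1
    funext i
    have h2 := h1 i (Finset.mem_univ i)
    rcases mul_eq_zero.1 h2 with h3 | h3
    · exact absurd h3 (hm i).ne'
    · exact inner_self_eq_zero.1 h3
  have hS : Function.Surjective T :=
    (LinearMap.injective_iff_surjective_of_finrank_eq_finrank
      (Subspace.dual_finrank_eq (K := ℝ) (V := W)).symm).1 hT
  obtain ⟨v, hv⟩ := hS φ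
  refine ⟨massMul m (v : Vec d n), ⟨by rw [hinv]; exact v.2, fun w => by rw [← hv]; rfl⟩, ?_⟩
  rintro p ⟨hp, hp'⟩
  have : T ⟨massInv m p, hp⟩ = T v := by
    rw [hv]; ext w; rw [← hp' w]
    change pairing (massMul m (massInv m p)) (w : Vec d n) = _
    rw [hmul]
  have := congrArg (fun w : W => massMul m (w : Vec d n)) (hT this)
  simpa [hmul] using this

/-- The tautological one-form `θ = ∑ᵢ pᵢ dqᵢ`: at the point `x = (p, q)` it maps `u = (δp, δq)` to
`⟨p, δq⟩`. It depends linearly on the point `x` too. Restricted to `T*Z` it is the tautological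
one-form of `T*Z`, for there `δq` is tangent to `Z`. -/
def tautologicalForm : LinearMap.BilinForm ℝ (Phase d n) :=
  pairing.compl₁₂ (LinearMap.fst ℝ (Vec d n) (Vec d n)) (LinearMap.snd ℝ (Vec d n) (Vec d n))

/-- The canonical symplectic form `ω = -dθ`, that is `ω(u, v) = θ_v(u) - θ_u(v)`. -/
def canonicalForm : LinearMap.BilinForm ℝ (Phase d n) :=
  tautologicalForm.flip - tautologicalForm

/-- The two-form `ω_⊖ = π₋^* ω - π₊^* ω` on pairs `(x₋, x₊)` of phase space points, with
`π₋` the projection to the left and `π₊` the projection to the right factor. -/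
def omegaMinus : LinearMap.BilinForm ℝ (Phase d n × Phase d n) :=
  canonicalForm.compl₁₂ (LinearMap.fst ℝ (Phase d n) (Phase d n))
      (LinearMap.fst ℝ (Phase d n) (Phase d n)) -
    canonicalForm.compl₁₂ (LinearMap.snd ℝ (Phase d n) (Phase d n))
      (LinearMap.snd ℝ (Phase d n) (Phase d n))

/-! ## Cluster coordinates of a set partition -/

/-- Set partitions of `{1, …, n}`; `⊥` is the partition into singletons. -/
abbrev SetPartition (n : ℕ) : Type := Finpartition (Finset.univ : Finset (Fin n))

/-- The mass of the cluster of the particle `i`. -/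
def clusterMass (m : Fin n → ℝ) (C : SetPartition n) (i : Fin n) : ℝ := ∑ j ∈ C.part i, m j

/-- The external component `q^E`: each position is replaced by the barycenter of its cluster. -/
def posE (m : Fin n → ℝ) (C : SetPartition n) (q : Vec d n) : Vec d n :=
  fun i => (clusterMass m C i)⁻¹ • ∑ j ∈ C.part i, m j • q j

/-- The internal component `q^I`. -/
def posI (m : Fin n → ℝ) (C : SetPartition n) (q : Vec d n) : Vec d n := q - posE m C q

/-- The external component `p^E` of a momentum vector: the total momentum of each cluster is
distributed over its particles in proportion to their masses. -/
def momE (m : Fin n → ℝ) (C : SetPartition n) (p : Vec d n) : Vec d n :=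
  fun i => (m i / clusterMass m C i) • ∑ j ∈ C.part i, p j

/-- The internal component `p^I` of a momentum vector. -/
def momI (m : Fin n → ℝ) (C : SetPartition n) (p : Vec d n) : Vec d n := p - momE m C p

/-- The external kinetic energy `K^E(p) = K(p^E)`. -/
def kineticE (m : Fin n → ℝ) (C : SetPartition n) (p : Vec d n) : ℝ := kinetic m (momE m C p)

/-- The collision subspace `Δ^E`: all particles of a cluster are at the same position. -/
def collisionSpace (m : Fin n → ℝ) (C : SetPartition n) : Set (Vec d n) :=
  {q | q ∈ centerOfMass m ∧ ∀ i j, C.part i = C.part j → q i = q j}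

/-- The internal subspace `Δ^I`, the kernel of `q ↦ q^E` on `M`. -/
def internalSpace (m : Fin n → ℝ) (C : SetPartition n) : Set (Vec d n) :=
  {q | q ∈ centerOfMass m ∧ posE m C q = 0}

/-- Replacing each value by the weighted cluster mean does not change the weighted sum. -/
theorem sum_cluster (m : Fin n → ℝ) (hm : ∀ i, 0 < m i) (C : SetPartition n)
    {F : Type*} [AddCommGroup F] [Module ℝ F] (g : Fin n → F) :
    ∑ i, m i • (clusterMass m C i)⁻¹ • ∑ j ∈ C.part i, g j = ∑ j, g j := by
  have hpos : ∀ i, 0 < clusterMass m C i := fun i =>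
    Finset.sum_pos (fun j _ => hm j) ⟨i, C.mem_part (Finset.mem_univ i)⟩
  have hmem : ∀ i j, j ∈ C.part i ↔ i ∈ C.part j := fun i j => by
    rw [C.mem_part_iff_part_eq_part (Finset.mem_univ _) (Finset.mem_univ _),
      C.mem_part_iff_part_eq_part (Finset.mem_univ _) (Finset.mem_univ _), eq_comm]
  have heq : ∀ i j, i ∈ C.part j → clusterMass m C i = clusterMass m C j := fun i j h => by
    rw [C.mem_part_iff_part_eq_part (Finset.mem_univ _) (Finset.mem_univ _)] at h
    simp [clusterMass, h]
  simp only [Finset.smul_sum]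
  rw [Finset.sum_comm' (t' := Finset.univ) (s' := fun j => C.part j)
    (by intro i j; simp [hmem i j])]
  refine Finset.sum_congr rfl fun j _ => ?_
  rw [Finset.sum_congr rfl (g := fun i => (m i * (clusterMass m C j)⁻¹) • g j)
    (fun i hi => by rw [heq i j hi, smul_smul]), ← Finset.sum_smul, ← Finset.sum_mul]
  change (clusterMass m C j * _) • _ = _
  rw [mul_inv_cancel₀ (hpos j).ne', one_smul]

/-- `q ↦ q^E` and `q ↦ q^I` are the `𝓜`-orthogonal projections of `M` to `Δ^E` and `Δ^I`. -/
theorem posE_spec (m : Fin n → ℝ) (hm : ∀ i, 0 < m i) (C : SetPartition n) (q : Vec d n)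
    (hq : q ∈ centerOfMass m) :
    posE m C q ∈ collisionSpace m C ∧ posI m C q ∈ internalSpace m C ∧
      ∀ r ∈ collisionSpace m C, massInner m r (posI m C q) = 0 := by
  have hpart : ∀ i j, j ∈ C.part i → C.part j = C.part i := fun i j h =>
    (C.mem_part_iff_part_eq_part (Finset.mem_univ _) (Finset.mem_univ _)).1 h
  have hpos : ∀ i, 0 < clusterMass m C i := fun i =>
    Finset.sum_pos (fun j _ => hm j) ⟨i, C.mem_part (Finset.mem_univ i)⟩
  have hE : ∀ i j, C.part i = C.part j → posE m C q i = posE m C q j := fun i j h => by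
    simp [posE, clusterMass, h]
  have hsum : ∑ i, m i • posE m C q i = ∑ i, m i • q i :=
    sum_cluster m hm C fun j => m j • q j
  have hidem : ∀ i, ∑ j ∈ C.part i, m j • posE m C q j = ∑ j ∈ C.part i, m j • q j := fun i => by
    rw [Finset.sum_congr rfl (g := fun j => m j • posE m C q i)
      (fun j hj => by rw [hE j i (hpart i j hj)]), ← Finset.sum_smul]
    change clusterMass m C i • ((clusterMass m C i)⁻¹ • _) = _
    rw [smul_smul, mul_inv_cancel₀ (hpos i).ne', one_smul]
  have hq' : ∑ i, m i • q i = 0 := hq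
  refine ⟨⟨hsum.trans hq', hE⟩, ⟨?_, ?_⟩, ?_⟩
  · change ∑ i, m i • (q i - posE m C q i) = 0
    simp only [smul_sub, Finset.sum_sub_distrib]
    rw [hsum, hq', sub_zero]
  · funext i
    change (clusterMass m C i)⁻¹ • ∑ j ∈ C.part i, m j • (q j - posE m C q j) = 0
    simp only [smul_sub, Finset.sum_sub_distrib]
    rw [hidem, sub_self]
  · rintro r ⟨-, hr⟩
    change ∑ i, inner ℝ (r i) (m i • (q i - posE m C q i)) = 0
    simp only [smul_sub, inner_sub_right, Finset.sum_sub_distrib]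
    rw [sub_eq_zero, ← sum_cluster m hm C fun j => (inner ℝ (r j) (m j • q j) : ℝ)]
    refine Finset.sum_congr rfl fun i _ => ?_
    rw [Finset.sum_congr rfl (g := fun j => (inner ℝ (r i) (m j • q j) : ℝ))
      (fun j hj => by rw [hr j i (hpart i j hj)]), ← inner_sum]
    simp only [posE, real_inner_smul_right, smul_eq_mul]

/-- The internal sphere `𝕊^I = {q ∈ Δ^I | J(q) = 1/2}`, with `J(q) = ⟨q, q⟩_𝓜 / 2`. -/
def sphereI (m : Fin n → ℝ) (C : SetPartition n) : Set (Vec d n) :=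
  {q | q ∈ internalSpace m C ∧ massInner m q q / 2 = 1 / 2}

/-- The cylinder `Z = 𝕊^I × Δ^E`, as a subset of `M = Δ^I ⊕ Δ^E`. -/
def cylinder (m : Fin n → ℝ) (C : SetPartition n) : Set (Vec d n) :=
  {q | ∃ s ∈ sphereI m C, ∃ e ∈ collisionSpace m C, q = s + e}

/-- The Poincaré surface `P = T*Z`. -/
def poincareSurface (m : Fin n → ℝ) (C : SetPartition n) : Set (Phase d n) :=
  cotangentBundle m (cylinder m C)

/-- The set `L_{𝒞; E₋, E₊}` of pairs `((p₋, q₋), (p₊, q₊))` in `P × P`. -/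
def lagrangianRelation (m : Fin n → ℝ) (C : SetPartition n) (Em Ep : ℝ) :
    Set (Phase d n × Phase d n) :=
  {x | ∃ pm qm pp qp : Vec d n, x = ((pm, qm), (pp, qp)) ∧
    (pm, qm) ∈ poincareSurface m C ∧ (pp, qp) ∈ poincareSurface m C ∧
    momI m C pm = 0 ∧ momI m C pp = 0 ∧ momE m C pp = momE m C pm ∧
    kineticE m C pm < min Em Ep ∧ kineticE m C pp < min Em Ep ∧
    posE m C qp - (Real.sqrt (2 * (Ep - kineticE m C pp)))⁻¹ • posE m C (massInv m pp) =
      posE m C qm + (Real.sqrt (2 * (Em - kineticE m C pm)))⁻¹ • posE m C (massInv m pm)}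

end ClusterScattering

end

/-! Everything is expressed through velocities `v = 𝓜⁻¹p`. The maps `q ↦ q^E` and `q ↦ q^I` are
complementary `𝓜`-orthogonal projections of the whole of `(ℝ^d)^n`, and `p ↦ p^E` is the first of
them acting on velocities. Hence `P` is the zero set of `2d + 2` equations in phase space: `∑ mᵢqᵢ =
0`, `|q^I|² = 1`, `∑ mᵢvᵢ = 0`, `⟨q^I, v⟩ = 0`. The form on `P` is nondegenerate because fibre
vectors detect `δq` and lifts of vectors of `TZ` detect `δp`.

On `L` the two momenta agree and are external, so the last condition reads `(q₊)^E - (q₋)^E = c(K^E)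
v^E`, where `c` is the sum of the two inverse speeds. The right side is the `𝓜`-gradient of `-√(2(E₊
- K^E)) - √(2(E₋ - K^E))` as a function of `v`; its derivative `D` is therefore self-adjoint, and
this symmetry is the isotropy of `L` (`exists_hasFDerivAt_displacement`,
`omegaMinus_eq_zero_of_mem_tangentSpaceAt`).

For the dimension, `L` is the zero set of a submersion with `2nd + 2d + 2` components on a space of
dimension `4nd` (`mem_lagrangianRelation_iff`, `isEmbeddedSubmanifold_lagrangianRelation`). This
leaves `2(nd - d - 1) = dim P`, half the dimension of `P × P`. -/

open scoped ContDiff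

noncomputable section

namespace ClusterScattering

/-! ### Submersions, products and tangent vectors of subsets of a vector space -/

section GeneralSubmanifolds

variable {E : Type*} [NormedAddCommGroup E] [NormedSpace ℝ E]

/-- A set that is locally the zero set of a submersion to a finite-dimensional space is an
embedded submanifold. -/
theorem IsEmbeddedSubmanifold.of_submersion (F : Type*) [NormedAddCommGroup F] [NormedSpace ℝ F]
    [FiniteDimensional ℝ F] {k : ℕ} {S : Set E}
    (hk : k + Module.finrank ℝ F = Module.finrank ℝ E)
    (h : ∀ x ∈ S, ∃ (U : Set E) (f : E → F) (f' : E →L[ℝ] F), IsOpen U ∧ x ∈ U ∧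
      ContDiffOn ℝ ∞ f U ∧ (∀ y ∈ U, y ∈ S ↔ f y = 0) ∧ HasFDerivAt f f' x ∧
      Function.Surjective f') : IsEmbeddedSubmanifold k S := by
  refine ⟨Module.finrank ℝ F, hk, fun x hx => ?_⟩
  obtain ⟨U, f, f', hU, hxU, hf, hS, hf', hsurj⟩ := h x hx
  let e : F ≃L[ℝ] (Fin (Module.finrank ℝ F) → ℝ) := ContinuousLinearEquiv.ofFinrankEq (by simp)
  refine ⟨U, e ∘ f, hU, hxU, e.contDiff.comp_contDiffOn hf, ?_, ?_⟩
  · ext y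
    simp only [Set.mem_inter_iff, Set.mem_ofPred_eq, Function.comp_apply,
      EmbeddingLike.map_eq_zero_iff]
    exact ⟨fun ⟨h1, h2⟩ => ⟨h2, (hS y h2).1 h1⟩, fun ⟨h1, h2⟩ => ⟨(hS y h1).2 h2, h1⟩⟩
  · have : HasFDerivAt (e ∘ f) ((e : F →L[ℝ] (Fin (Module.finrank ℝ F) → ℝ)).comp f') x :=
      (e : F →L[ℝ] (Fin (Module.finrank ℝ F) → ℝ)).hasFDerivAt.comp x hf'
    rw [this.fderiv]
    exact e.surjective.comp hsurj

theorem IsEmbeddedSubmanifold.prod [FiniteDimensional ℝ E] {k l : ℕ} {S T : Set E}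
    (hS : IsEmbeddedSubmanifold k S) (hT : IsEmbeddedSubmanifold l T) :
    IsEmbeddedSubmanifold (k + l) (S ×ˢ T) := by
  obtain ⟨c, hc, hS⟩ := hS
  obtain ⟨c', hc', hT⟩ := hT
  refine .of_submersion ((Fin c → ℝ) × (Fin c' → ℝ)) (by simp; omega) ?_
  rintro ⟨x, y⟩ ⟨hx, hy⟩
  obtain ⟨U, f, hU, hxU, hf, hSU, hfs⟩ := hS x hx
  obtain ⟨V, g, hV, hyV, hg, hTV, hgs⟩ := hT y hy
  have hf' := ((hf.contDiffAt (hU.mem_nhds hxU)).differentiableAt (by simp)).hasFDerivAt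
  have hg' := ((hg.contDiffAt (hV.mem_nhds hyV)).differentiableAt (by simp)).hasFDerivAt
  refine ⟨U ×ˢ V, Prod.map f g, (fderiv ℝ f x).prodMap (fderiv ℝ g y), hU.prod hV, ⟨hxU, hyV⟩,
    hf.prodMap hg, ?_, hf'.prodMap (x, y) hg', hfs.prodMap hgs⟩
  rintro ⟨a, b⟩ ⟨ha, hb⟩
  have h1 : a ∈ S ↔ f a = 0 :=
    ⟨fun h => (hSU.le ⟨h, ha⟩).2, fun h => (hSU.ge ⟨ha, h⟩).1⟩
  have h2 : b ∈ T ↔ g b = 0 :=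
    ⟨fun h => (hTV.le ⟨h, hb⟩).2, fun h => (hTV.ge ⟨hb, h⟩).1⟩
  simp [h1, h2]

/-- Tangent vectors are annihilated by the derivative of a map that vanishes on the set. -/
theorem map_tangent_eq_zero {F : Type*} [NormedAddCommGroup F] [NormedSpace ℝ F] {S : Set E}
    {f : E → F} {f' : E →L[ℝ] F} {x v : E} (hf : HasFDerivAt f f' x) (hS : ∀ y ∈ S, f y = 0)
    (hv : v ∈ tangentSpaceAt S x) : f' v = 0 := by
  obtain ⟨γ, -, rfl, hγS, hγ⟩ := hv
  refine (hf.comp_hasDerivAt 0 hγ).unique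
    ((hasDerivAt_const (0 : ℝ) (0 : F)).congr_of_eventuallyEq ?_)
  filter_upwards [hγS] with t ht using hS _ ht

theorem mk_mem_tangentSpaceAt_prod_left {E' : Type*} [NormedAddCommGroup E'] [NormedSpace ℝ E']
    {S : Set E} {T : Set E'} {x v : E} {y : E'} (hy : y ∈ T) (hv : v ∈ tangentSpaceAt S x) :
    (v, (0 : E')) ∈ tangentSpaceAt (S ×ˢ T) (x, y) := by
  obtain ⟨γ, h1, h2, h3, h4⟩ := hv
  exact ⟨fun t => (γ t, y), h1.prodMk contDiffAt_const, by simp [h2],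
    h3.mono fun t ht => ⟨ht, hy⟩, h4.prodMk (hasDerivAt_const _ _)⟩

theorem mk_mem_tangentSpaceAt_prod_right {E' : Type*} [NormedAddCommGroup E'] [NormedSpace ℝ E']
    {S : Set E} {T : Set E'} {x : E} {y v : E'} (hx : x ∈ S) (hv : v ∈ tangentSpaceAt T y) :
    ((0 : E), v) ∈ tangentSpaceAt (S ×ˢ T) (x, y) := by
  obtain ⟨γ, h1, h2, h3, h4⟩ := hv
  exact ⟨fun t => (x, γ t), contDiffAt_const.prodMk h1, by simp [h2],
    h3.mono fun t ht => ⟨hx, ht⟩, (hasDerivAt_const _ _).prodMk h4⟩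

theorem fst_mem_tangentSpaceAt {E' : Type*} [NormedAddCommGroup E'] [NormedSpace ℝ E']
    {S : Set E} {T : Set E'} {x : E × E'} {v : E × E'} (hv : v ∈ tangentSpaceAt (S ×ˢ T) x) :
    v.1 ∈ tangentSpaceAt S x.1 := by
  obtain ⟨γ, h1, h2, h3, h4⟩ := hv
  exact ⟨fun t => (γ t).1, h1.fst, by simp [h2], h3.mono fun t ht => ht.1, h4.fst⟩

theorem snd_mem_tangentSpaceAt {E' : Type*} [NormedAddCommGroup E'] [NormedSpace ℝ E']
    {S : Set E} {T : Set E'} {x : E × E'} {v : E × E'} (hv : v ∈ tangentSpaceAt (S ×ˢ T) x) :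
    v.2 ∈ tangentSpaceAt T x.2 := by
  obtain ⟨γ, h1, h2, h3, h4⟩ := hv
  exact ⟨fun t => (γ t).2, h1.snd, by simp [h2], h3.mono fun t ht => ht.2, h4.snd⟩

end GeneralSubmanifolds

/-! ### The cluster projections and the mass inner product -/

section LinearAlgebra

variable {d n : ℕ}

/-- `massInv` as a continuous linear map. -/
def massInvL (m : Fin n → ℝ) : Vec d n →L[ℝ] Vec d n :=
  LinearMap.toContinuousLinearMap
    { toFun := massInv m
      map_add' := fun v w => by funext i; simp [massInv]
      map_smul' := fun c v => by funext i; simp [massInv, smul_comm c] }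

/-- `massMul` as a continuous linear map. -/
def massMulL (m : Fin n → ℝ) : Vec d n →L[ℝ] Vec d n :=
  LinearMap.toContinuousLinearMap
    { toFun := massMul m
      map_add' := fun v w => by funext i; simp [massMul]
      map_smul' := fun c v => by funext i; simp [massMul, smul_comm c] }

/-- `posE` as a continuous linear map. -/
def posEL (m : Fin n → ℝ) (C : SetPartition n) : Vec d n →L[ℝ] Vec d n :=
  LinearMap.toContinuousLinearMap
    { toFun := posE m C
      map_add' := fun v w => by funext i; simp [posE, Finset.sum_add_distrib]
      map_smul' := fun c v => by
        funext i; simp [posE, smul_comm _ c, ← Finset.smul_sum] }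

/-- `posI` as a continuous linear map. -/
def posIL (m : Fin n → ℝ) (C : SetPartition n) : Vec d n →L[ℝ] Vec d n :=
  ContinuousLinearMap.id ℝ _ - posEL m C

/-- The weighted sum `v ↦ ∑ᵢ mᵢ vᵢ`. -/
def weightedSum (m : Fin n → ℝ) : Vec d n →L[ℝ] EuclideanSpace ℝ (Fin d) :=
  LinearMap.toContinuousLinearMap
    { toFun := fun v => ∑ i, m i • v i
      map_add' := fun v w => by simp [Finset.sum_add_distrib]
      map_smul' := fun c v => by simp [smul_comm _ c, ← Finset.smul_sum] }

/-- The inner product `⟨·,·⟩_𝓜` as a continuous bilinear map. -/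
def massForm (m : Fin n → ℝ) : Vec d n →L[ℝ] Vec d n →L[ℝ] ℝ :=
  LinearMap.toContinuousBilinearMap (LinearMap.comp pairing (massMulL m).toLinearMap)

/-- The configuration with all particles at the same position. -/
def constVec (n : ℕ) (s : EuclideanSpace ℝ (Fin d)) : Vec d n := fun _ => s

variable (m : Fin n → ℝ) (C : SetPartition n)

theorem massInvL_apply (v : Vec d n) : massInvL m v = massInv m v := rfl
theorem massMulL_apply (v : Vec d n) : massMulL m v = massMul m v := rfl
theorem posEL_apply (v : Vec d n) : posEL m C v = posE m C v := rfl
theorem posIL_eq (v : Vec d n) : posIL m C v = v - posEL m C v := rfl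
theorem weightedSum_apply (v : Vec d n) : weightedSum m v = ∑ i, m i • v i := rfl
theorem massForm_apply (v w : Vec d n) : massForm m v w = pairing (massMul m v) w := rfl
theorem pairing_apply (v w : Vec d n) : pairing v w = ∑ i, inner ℝ (v i) (w i) := rfl

theorem massForm_eq_sum (v w : Vec d n) : massForm m v w = ∑ i, m i * inner ℝ (v i) (w i) := by
  simp [massForm_apply, pairing_apply, massMul, real_inner_smul_left]

theorem massForm_comm (v w : Vec d n) : massForm m v w = massForm m w v := by
  simp [massForm_eq_sum, real_inner_comm]

theorem massInner_eq (v w : Vec d n) : massInner m v w = massForm m v w := by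
  simp [massForm_eq_sum, massInner, pairing_apply, massMul, real_inner_smul_right]

theorem massForm_constVec (s : EuclideanSpace ℝ (Fin d)) (v : Vec d n) :
    massForm m (constVec n s) v = inner ℝ s (weightedSum m v) := by
  simp [massForm_eq_sum, constVec, weightedSum_apply, inner_sum, real_inner_smul_right]

theorem weightedSum_constVec (s : EuclideanSpace ℝ (Fin d)) :
    weightedSum m (constVec n s) = (∑ i, m i) • s := by
  simp [weightedSum_apply, constVec, Finset.sum_smul]

variable {m}

theorem massInvL_massMulL (hm : ∀ i, 0 < m i) (v : Vec d n) : massInvL m (massMulL m v) = v := by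
  funext i; simp [massInvL_apply, massMulL_apply, massInv, massMul, smul_smul, (hm i).ne']

theorem massMulL_massInvL (hm : ∀ i, 0 < m i) (v : Vec d n) : massMulL m (massInvL m v) = v := by
  funext i; simp [massInvL_apply, massMulL_apply, massInv, massMul, smul_smul, (hm i).ne']

theorem pairing_eq (hm : ∀ i, 0 < m i) (p v : Vec d n) :
    pairing p v = massForm m (massInvL m p) v := by
  rw [massForm_apply, ← massMulL_apply, massMulL_massInvL hm]

theorem massForm_self_nonneg (hm : ∀ i, 0 < m i) (v : Vec d n) : 0 ≤ massForm m v v := by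
  rw [massForm_eq_sum]
  exact Finset.sum_nonneg fun i _ => mul_nonneg (hm i).le real_inner_self_nonneg

theorem massForm_self_eq_zero (hm : ∀ i, 0 < m i) {v : Vec d n} (h : massForm m v v = 0) :
    v = 0 := by
  rw [massForm_eq_sum, Finset.sum_eq_zero_iff_of_nonneg
    (fun i _ => mul_nonneg (hm i).le real_inner_self_nonneg)] at h
  funext i
  have := h i (Finset.mem_univ i)
  simpa [(hm i).ne'] using this

theorem clusterMass_pos (hm : ∀ i, 0 < m i) (i : Fin n) : 0 < clusterMass m C i :=
  Finset.sum_pos (fun j _ => hm j) ⟨i, C.mem_part (Finset.mem_univ i)⟩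

theorem part_eq_of_mem {i j : Fin n} (h : j ∈ C.part i) : C.part j = C.part i :=
  (C.mem_part_iff_part_eq_part (Finset.mem_univ _) (Finset.mem_univ _)).1 h

theorem posEL_eq_self (hm : ∀ i, 0 < m i) {q : Vec d n}
    (h : ∀ i j, C.part i = C.part j → q i = q j) :
    posEL m C q = q := by
  funext i
  change (clusterMass m C i)⁻¹ • ∑ j ∈ C.part i, m j • q j = q i
  rw [Finset.sum_congr rfl (g := fun j => m j • q i)
    (fun j hj => by rw [h j i (part_eq_of_mem C hj)]), ← Finset.sum_smul, smul_smul]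
  change ((clusterMass m C i)⁻¹ * clusterMass m C i) • _ = _
  rw [inv_mul_cancel₀ (clusterMass_pos C hm i).ne', one_smul]

theorem posEL_apply_congr (q : Vec d n) {i j : Fin n} (h : C.part i = C.part j) :
    posEL m C q i = posEL m C q j := by
  simp [posEL_apply, posE, clusterMass, h]

theorem posEL_posEL (hm : ∀ i, 0 < m i) (q : Vec d n) : posEL m C (posEL m C q) = posEL m C q :=
  posEL_eq_self C hm fun _ _ h => posEL_apply_congr C q h

theorem posEL_constVec (hm : ∀ i, 0 < m i) (s : EuclideanSpace ℝ (Fin d)) :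
    posEL m C (constVec n s) = constVec n s := posEL_eq_self C hm fun _ _ _ => rfl

theorem posEL_posIL (hm : ∀ i, 0 < m i) (q : Vec d n) : posEL m C (posIL m C q) = 0 := by
  rw [posIL_eq, map_sub, posEL_posEL C hm, sub_self]

theorem posIL_posEL (hm : ∀ i, 0 < m i) (q : Vec d n) : posIL m C (posEL m C q) = 0 := by
  rw [posIL_eq, posEL_posEL C hm, sub_self]

theorem posIL_posIL (hm : ∀ i, 0 < m i) (q : Vec d n) : posIL m C (posIL m C q) = posIL m C q := by
  rw [posIL_eq, posEL_posIL C hm, sub_zero]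

theorem posIL_constVec (hm : ∀ i, 0 < m i) (s : EuclideanSpace ℝ (Fin d)) :
    posIL m C (constVec n s) = 0 := by
  rw [posIL_eq, posEL_constVec C hm, sub_self]

theorem weightedSum_posEL (hm : ∀ i, 0 < m i) (q : Vec d n) :
    weightedSum m (posEL m C q) = weightedSum m q :=
  sum_cluster m hm C fun j => m j • q j

theorem weightedSum_posIL (hm : ∀ i, 0 < m i) (q : Vec d n) : weightedSum m (posIL m C q) = 0 := by
  rw [posIL_eq, map_sub, weightedSum_posEL C hm, sub_self]

/-- Since `v^E` is constant on clusters, its pairing with `w` sees only the cluster means of `w`;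
this is `sum_cluster` applied to the summands of the pairing. -/
theorem massForm_posEL_posIL (hm : ∀ i, 0 < m i) (v w : Vec d n) :
    massForm m (posEL m C v) (posIL m C w) = 0 := by
  rw [massForm_eq_sum]
  change ∑ i, m i * inner ℝ (posE m C v i) (w i - posE m C w i) = 0
  simp only [inner_sub_right, mul_sub, Finset.sum_sub_distrib]
  rw [sub_eq_zero, ← sum_cluster m hm C fun j => (m j * inner ℝ (posE m C v j) (w j) : ℝ)]
  refine Finset.sum_congr rfl fun i _ => ?_
  rw [Finset.sum_congr rfl (g := fun j => (inner ℝ (posE m C v i) (m j • w j) : ℝ))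
    (fun j hj => by
      rw [show posE m C v j = posE m C v i from posEL_apply_congr C v (part_eq_of_mem C hj),
        real_inner_smul_right]), ← inner_sum]
  simp only [posE, real_inner_smul_right, smul_eq_mul]

theorem massForm_posIL_posEL (hm : ∀ i, 0 < m i) (v w : Vec d n) :
    massForm m (posIL m C v) (posEL m C w) = 0 := by
  rw [massForm_comm, massForm_posEL_posIL C hm]

theorem posEL_add_posIL (q : Vec d n) : posEL m C q + posIL m C q = q := by
  rw [posIL_eq, add_sub_cancel]

theorem massForm_posEL_left (hm : ∀ i, 0 < m i) (v w : Vec d n) :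
    massForm m (posEL m C v) w = massForm m (posEL m C v) (posEL m C w) := by
  conv_lhs => rw [← posEL_add_posIL C (m := m) w, map_add, massForm_posEL_posIL C hm, add_zero]

theorem massForm_posIL_left (hm : ∀ i, 0 < m i) (v w : Vec d n) :
    massForm m (posIL m C v) w = massForm m (posIL m C v) (posIL m C w) := by
  conv_lhs => rw [← posEL_add_posIL C (m := m) w, map_add, massForm_posIL_posEL C hm, zero_add]

theorem massForm_posEL_comm (hm : ∀ i, 0 < m i) (v w : Vec d n) :
    massForm m (posEL m C v) w = massForm m v (posEL m C w) := by
  rw [massForm_posEL_left C hm v, massForm_comm m v, massForm_posEL_left C hm w, massForm_comm]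

/-- The momentum projection is the position projection conjugated by the mass matrix, so all later
arguments need only one projection, applied to velocities. -/
theorem momE_eq (hm : ∀ i, 0 < m i) (p : Vec d n) :
    momE m C p = massMulL m (posEL m C (massInvL m p)) := by
  funext i
  change _ = m i • (clusterMass m C i)⁻¹ • ∑ j ∈ C.part i, m j • (m j)⁻¹ • p j
  rw [Finset.sum_congr rfl (g := fun j => p j)
    (fun j _ => by rw [smul_smul, mul_inv_cancel₀ (hm j).ne', one_smul]),
    smul_smul, ← div_eq_mul_inv]
  rfl

theorem momI_eq (hm : ∀ i, 0 < m i) (p : Vec d n) :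
    momI m C p = massMulL m (posIL m C (massInvL m p)) := by
  rw [momI, momE_eq C hm p, posIL_eq, map_sub, massMulL_massInvL hm]

theorem momI_eq_zero_iff (hm : ∀ i, 0 < m i) (p : Vec d n) :
    momI m C p = 0 ↔ posIL m C (massInvL m p) = 0 := by
  rw [momI_eq C hm]
  refine ⟨fun h => ?_, fun h => by rw [h, map_zero]⟩
  rw [← massInvL_massMulL hm (posIL m C (massInvL m p)), h, map_zero]

theorem kinetic_massMulL (hm : ∀ i, 0 < m i) (v : Vec d n) :
    kinetic m (massMulL m v) = massForm m v v / 2 := by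
  rw [massForm_eq_sum, Finset.sum_div]
  refine Finset.sum_congr rfl fun i _ => ?_
  have := (hm i).ne'
  simp only [massMulL_apply, massMul, real_inner_smul_left, real_inner_smul_right]
  field_simp

theorem kineticE_eq (hm : ∀ i, 0 < m i) (p : Vec d n) : kineticE m C p =
    massForm m (posEL m C (massInvL m p)) (posEL m C (massInvL m p)) / 2 := by
  rw [kineticE, momE_eq C hm p, kinetic_massMulL hm]

end LinearAlgebra

/-! ### Equations and tangent spaces of the cylinder and its cotangent bundle -/

section Cylinder

variable {d n : ℕ} {m : Fin n → ℝ} (C : SetPartition n)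

/-- All quadratic constraints have the shape `⟨S y, T y⟩` with `S`, `T` linear, so this one product
rule differentiates each of them. -/
theorem exists_hasFDerivAt_massForm {X : Type*} [NormedAddCommGroup X] [NormedSpace ℝ X]
    (m : Fin n → ℝ) (S T : X →L[ℝ] Vec d n) (x : X) :
    ∃ f' : X →L[ℝ] ℝ, HasFDerivAt (fun y => massForm m (S y) (T y)) f' x ∧
      ∀ w, f' w = massForm m (S x) (T w) + massForm m (S w) (T x) :=
  ⟨_, (massForm m).hasFDerivAt_of_bilinear S.hasFDerivAt T.hasFDerivAt, fun w => by simp⟩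

theorem contDiff_massForm {X : Type*} [NormedAddCommGroup X] [NormedSpace ℝ X]
    (m : Fin n → ℝ) (S T : X →L[ℝ] Vec d n) :
    ContDiff ℝ ∞ fun y => massForm m (S y) (T y) := by fun_prop

theorem mem_centerOfMass_iff (q : Vec d n) : q ∈ centerOfMass m ↔ weightedSum m q = 0 := Iff.rfl

/-- The summands of a point of `Z` can only be `q^I` and `q^E`. As `q^I` always has weighted sum
zero, the two center of mass conditions reduce to the one on `q`. -/
theorem mem_cylinder_iff (hm : ∀ i, 0 < m i) (q : Vec d n) : q ∈ cylinder m C ↔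
    weightedSum m q = 0 ∧ massForm m (posIL m C q) (posIL m C q) = 1 := by
  constructor
  · rintro ⟨s, ⟨⟨hs, hsE⟩, hs1⟩, e, ⟨he, he'⟩, rfl⟩
    rw [mem_centerOfMass_iff] at hs he
    have h1 : posIL m C s = s := by rw [posIL_eq, posEL_apply, hsE, sub_zero]
    have h2 : posIL m C e = 0 := by rw [posIL_eq, posEL_eq_self C hm he', sub_self]
    rw [map_add, map_add, hs, he, h1, h2, add_zero, add_zero, ← massInner_eq]
    exact ⟨rfl, by linarith⟩
  · rintro ⟨h1, h2⟩
    refine ⟨posIL m C q, ⟨⟨?_, posEL_posIL C hm q⟩, ?_⟩, posEL m C q, ⟨?_, ?_⟩, ?_⟩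
    · rw [mem_centerOfMass_iff, weightedSum_posIL C hm]
    · rw [massInner_eq, h2]
    · rw [mem_centerOfMass_iff, weightedSum_posEL C hm, h1]
    · exact fun i j h => posEL_apply_congr C q h
    · rw [add_comm, posEL_add_posIL]

/-- A smooth curve in the cylinder with given initial velocity, obtained by normalizing the
internal part of a straight line. -/
theorem exists_curve_cylinder (hm : ∀ i, 0 < m i) {q v : Vec d n} (hq : q ∈ cylinder m C)
    (hv : weightedSum m v = 0) (hqv : massForm m (posIL m C q) v = 0) :
    ∃ γ : ℝ → Vec d n, ContDiff ℝ ∞ γ ∧ γ 0 = q ∧ (∀ t, γ t ∈ cylinder m C) ∧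
      HasDerivAt γ v 0 := by
  rw [mem_cylinder_iff C hm] at hq
  obtain ⟨hq0, hq1⟩ := hq
  set a := massForm m (posIL m C v) (posIL m C v) with ha
  have ha0 : 0 ≤ a := massForm_self_nonneg hm _
  have hN : ∀ t : ℝ, 0 < 1 + a * t ^ 2 := fun t => by positivity
  -- As `q^I ⟂ v^I`, one has `|q^I + t v^I|² = 1 + a t²` without a linear term. The normalizing
  -- factor `h` thus has derivative `0` at `0` and leaves the initial velocity `v` unchanged.
  set h : ℝ → ℝ := fun t => (√(1 + a * t ^ 2))⁻¹ with hh
  have hsm : ContDiff ℝ ∞ h := by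
    have h1 : ContDiff ℝ ∞ fun t : ℝ => 1 + a * t ^ 2 := by fun_prop
    exact (h1.sqrt fun t => (hN t).ne').inv fun t => (Real.sqrt_pos.2 (hN t)).ne'
  have h0 : h 0 = 1 := by simp [hh]
  have hd : HasDerivAt h 0 0 := by
    have h1 : HasDerivAt (fun t : ℝ => 1 + a * t ^ 2) 0 0 := by
      simpa using ((hasDerivAt_pow 2 (0 : ℝ)).const_mul a).const_add 1
    have h2 := (h1.sqrt (hN 0).ne').inv (Real.sqrt_pos.2 (hN 0)).ne'
    rw [zero_div, neg_zero, zero_div] at h2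
    exact h2
  have hl : HasDerivAt (fun t : ℝ => q + t • v) v 0 := by
    simpa using ((hasDerivAt_id (0 : ℝ)).smul_const v).const_add q
  refine ⟨fun t => posEL m C (q + t • v) + h t • posIL m C (q + t • v), ?_, ?_, ?_, ?_⟩
  · fun_prop
  · simp only [h0, zero_smul, add_zero, one_smul, posEL_add_posIL]
  · intro t
    rw [mem_cylinder_iff C hm]
    constructor
    · simp [weightedSum_posEL C hm, weightedSum_posIL C hm, hq0, hv]
    · have hqv' : massForm m (posIL m C q) (posIL m C v) = 0 := by
        rw [← massForm_posIL_left C hm, hqv]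
      have hvq' : massForm m (posIL m C v) (posIL m C q) = 0 := by rw [massForm_comm, hqv']
      have : h t ^ 2 * (1 + a * t ^ 2) = 1 := by
        rw [hh]
        simp only [inv_pow]
        rw [Real.sq_sqrt (hN t).le, inv_mul_cancel₀ (hN t).ne']
      simp only [map_add, map_smul, posIL_posEL C hm, posIL_posIL C hm, zero_add, smul_zero,
        add_apply, smul_apply, smul_eq_mul, hqv', hvq',
        hq1, ← ha]
      linear_combination this
  · have h1 := (posEL m C).hasFDerivAt.comp_hasDerivAt (0 : ℝ) hl
    have h2 := (posIL m C).hasFDerivAt.comp_hasDerivAt (0 : ℝ) hl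
    have h3 := h1.add (hd.smul h2)
    simp only [h0, zero_smul, add_zero, one_smul, posEL_add_posIL] at h3
    exact h3

/-- Differentiating the equations of `Z` gives one direction; the explicit normalized curve gives
the other and replaces the implicit function theorem. -/
theorem mem_tangentSpaceAt_cylinder_iff (hm : ∀ i, 0 < m i) {q v : Vec d n}
    (hq : q ∈ cylinder m C) : v ∈ tangentSpaceAt (cylinder m C) q ↔
      weightedSum m v = 0 ∧ massForm m (posIL m C q) v = 0 := by
  constructor
  · intro hv
    refine ⟨map_tangent_eq_zero (weightedSum m).hasFDerivAt
      (fun y hy => ((mem_cylinder_iff C hm y).1 hy).1) hv, ?_⟩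
    obtain ⟨f', hf', hf'w⟩ := exists_hasFDerivAt_massForm m (posIL m C) (posIL m C) q
    have := map_tangent_eq_zero (hf'.sub_const 1)
      (fun y hy => sub_eq_zero.2 ((mem_cylinder_iff C hm y).1 hy).2) hv
    rw [hf'w, massForm_comm m (posIL m C v)] at this
    rw [massForm_posIL_left C hm]
    linarith
  · rintro ⟨h1, h2⟩
    obtain ⟨γ, h3, h4, h5, h6⟩ := exists_curve_cylinder C hm hq h1 h2
    exact ⟨γ, h3.contDiffAt, h4, .of_forall h5, h6⟩

theorem mem_poincareSurface_iff (hm : ∀ i, 0 < m i) (x : Phase d n) :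
    x ∈ poincareSurface m C ↔ weightedSum m x.2 = 0 ∧
      massForm m (posIL m C x.2) (posIL m C x.2) = 1 ∧ weightedSum m (massInvL m x.1) = 0 ∧
      massForm m (posIL m C x.2) (massInvL m x.1) = 0 := by
  constructor
  · rintro ⟨h1, h2⟩
    have h3 := (mem_tangentSpaceAt_cylinder_iff C hm h1).1 h2
    rw [mem_cylinder_iff C hm] at h1
    exact ⟨h1.1, h1.2, h3.1, h3.2⟩
  · rintro ⟨h1, h2, h3, h4⟩
    have h5 := (mem_cylinder_iff C hm x.2).2 ⟨h1, h2⟩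
    exact ⟨h5, (mem_tangentSpaceAt_cylinder_iff C hm h5).2 ⟨h3, h4⟩⟩

end Cylinder

/-! ### The Poincaré surface as a symplectic submanifold -/

section PoincareSurface

variable {d n : ℕ} {m : Fin n → ℝ} (C : SetPartition n)

/-- With at most one particle, the partition into singletons is the only one. The bound `2 ≤ n`,
together with `0 < d`, keeps the natural number `n * d - d - 1` from being truncated. -/
theorem two_le_of_ne_bot {C : SetPartition n} (hC : C ≠ ⊥) : 2 ≤ n := by
  by_contra! h
  have : Subsingleton (Fin n) := Fin.subsingleton_iff_le_one.2 (by omega)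
  refine hC (le_bot_iff.1 fun s hs => ?_)
  obtain ⟨i, hi⟩ := C.nonempty_of_mem_parts hs
  refine ⟨{i}, by simp, fun j _ => ?_⟩
  simp [Subsingleton.elim j i]

theorem totalMass_pos (hm : ∀ i, 0 < m i) (hn : 0 < n) : 0 < ∑ i, m i :=
  Finset.sum_pos (fun i _ => hm i) ⟨⟨0, hn⟩, Finset.mem_univ _⟩

theorem finrank_vec : Module.finrank ℝ (Vec d n) = n * d := by
  rw [Module.finrank_pi_fintype]
  simp

theorem finrank_phase : Module.finrank ℝ (Phase d n) = n * d + n * d := by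
  rw [Module.finrank_prod, finrank_vec]

/-- The constant configuration with prescribed weighted sum. -/
theorem exists_constVec (hm : ∀ i, 0 < m i) (hn : 0 < n) (s : EuclideanSpace ℝ (Fin d)) :
    ∃ t : EuclideanSpace ℝ (Fin d), weightedSum m (constVec n t) = s :=
  ⟨(∑ i, m i)⁻¹ • s, by
    rw [weightedSum_constVec, smul_smul, mul_inv_cancel₀ (totalMass_pos hm hn).ne', one_smul]⟩

theorem massForm_posIL_constVec (hm : ∀ i, 0 < m i) (q : Vec d n)
    (s : EuclideanSpace ℝ (Fin d)) : massForm m (posIL m C q) (constVec n s) = 0 := by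
  rw [← posEL_constVec C hm, massForm_posIL_posEL C hm]

theorem isEmbeddedSubmanifold_poincareSurface (hm : ∀ i, 0 < m i) (hd : 0 < d) (hn : 2 ≤ n) :
    IsEmbeddedSubmanifold (2 * (n * d - d - 1)) (poincareSurface (d := d) m C) := by
  have hnd : 2 * d ≤ n * d := Nat.mul_le_mul_right d hn
  refine .of_submersion
    (EuclideanSpace ℝ (Fin d) × ℝ × EuclideanSpace ℝ (Fin d) × ℝ) ?_ fun x hx => ?_
  · rw [finrank_phase]
    simp only [Module.finrank_prod, finrank_euclideanSpace, Fintype.card_fin, Module.finrank_self]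
    omega
  let fs := ContinuousLinearMap.fst ℝ (Vec d n) (Vec d n)
  let sn := ContinuousLinearMap.snd ℝ (Vec d n) (Vec d n)
  obtain ⟨f1, hf1, hf1w⟩ := exists_hasFDerivAt_massForm m ((posIL m C).comp sn)
    ((posIL m C).comp sn) x
  obtain ⟨f2, hf2, hf2w⟩ := exists_hasFDerivAt_massForm m ((posIL m C).comp sn)
    ((massInvL m).comp fs) x
  have c1 := contDiff_massForm m ((posIL m C).comp sn) ((posIL m C).comp sn)
  have c2 := contDiff_massForm m ((posIL m C).comp sn) ((massInvL m).comp fs)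
  refine ⟨Set.univ, fun x => (weightedSum m x.2,
    massForm m (posIL m C x.2) (posIL m C x.2) - 1, weightedSum m (massInvL m x.1),
    massForm m (posIL m C x.2) (massInvL m x.1)), _, isOpen_univ, trivial, ?_, ?_,
    ((weightedSum m).comp sn).hasFDerivAt.prodMk ((hf1.sub_const 1).prodMk
      (((weightedSum m).comp ((massInvL m).comp fs)).hasFDerivAt.prodMk hf2)), ?_⟩
  · exact (((weightedSum m).comp sn).contDiff.prodMk ((c1.sub contDiff_const).prodMk
      (((weightedSum m).comp ((massInvL m).comp fs)).contDiff.prodMk c2))).contDiffOn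
  · intro y _
    simp [mem_poincareSurface_iff C hm, sub_eq_zero]
  · rintro ⟨s, α, t, β⟩
    obtain ⟨s', hs⟩ := exists_constVec hm (by omega) s
    obtain ⟨t', ht⟩ := exists_constVec hm (by omega) t
    obtain ⟨-, h1, -, h2⟩ := (mem_poincareSurface_iff C hm x).1 hx
    -- Constant configurations adjust the weighted sums and are orthogonal to `q^I`; multiples of
    -- `q^I` adjust the other two equations and have weighted sum zero. The factor `1/2` cancels the
    -- `2` from differentiating `|q^I|²`, and the cross term `(α/2)⟨q^I, v⟩` vanishes on `P`.
    refine ⟨(massMulL m (constVec n t' + β • posIL m C x.2), constVec n s' +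
      (α / 2) • posIL m C x.2), ?_⟩
    have hp : massForm m (constVec n s') (massInvL m x.1) =
        inner ℝ s' (weightedSum m (massInvL m x.1)) := massForm_constVec m s' _
    simp [hf1w, hf2w, fs, sn, massInvL_massMulL hm, hs, ht, weightedSum_posIL C hm,
      posIL_posIL C hm, posIL_constVec C hm, h1, h2, massForm_posIL_constVec C hm]

theorem canonicalForm_eq (hm : ∀ i, 0 < m i) (u v : Phase d n) : canonicalForm u v =
    massForm m (massInvL m v.1) u.2 - massForm m (massInvL m u.1) v.2 := by
  rw [← pairing_eq hm, ← pairing_eq hm]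
  rfl

/-- Vectors of `T (T*Z)` in the fibre direction. -/
theorem vertical_mem_tangentSpaceAt (hm : ∀ i, 0 < m i) {x : Phase d n}
    (hx : x ∈ poincareSurface m C) {w : Vec d n} (hw : weightedSum m w = 0)
    (hqw : massForm m (posIL m C x.2) w = 0) :
    (massMulL m w, (0 : Vec d n)) ∈ tangentSpaceAt (poincareSurface m C) x := by
  obtain ⟨p, q⟩ := x
  refine ⟨fun t => (p + t • massMulL m w, q), ?_, by simp, .of_forall fun t => ?_, ?_⟩
  · fun_prop
  · rw [mem_poincareSurface_iff C hm] at hx ⊢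
    obtain ⟨h1, h2, h3, h4⟩ := hx
    refine ⟨h1, h2, ?_, ?_⟩ <;> simp_all [massInvL_massMulL hm]
  · have : HasDerivAt (fun t : ℝ => p + t • massMulL m w) (massMulL m w) 0 := by
      simpa using ((hasDerivAt_id (0 : ℝ)).smul_const (massMulL m w)).const_add p
    exact this.prodMk (hasDerivAt_const _ _)

/-- Vectors of `T Z` lift to `T (T*Z)`. -/
theorem exists_lift_mem_tangentSpaceAt (hm : ∀ i, 0 < m i) {x : Phase d n}
    (hx : x ∈ poincareSurface m C) {w : Vec d n} (hw : weightedSum m w = 0)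
    (hqw : massForm m (posIL m C x.2) w = 0) :
    ∃ u : Vec d n, (u, w) ∈ tangentSpaceAt (poincareSurface m C) x := by
  obtain ⟨p, q⟩ := x
  obtain ⟨γ, hγ, hγ0, hγZ, hγ'⟩ := exists_curve_cylinder C hm hx.1 hw hqw
  obtain ⟨-, -, h3, h4⟩ := (mem_poincareSurface_iff C hm _).1 hx
  -- The momentum is carried along `γ` by removing the component of its velocity along the unit
  -- vector `γ(t)^I`, which keeps it in the cotangent space at `γ(t)`.
  let δ : ℝ → Vec d n := fun t =>
    p - (massForm m (posIL m C (γ t)) (massInvL m p)) • massMulL m (posIL m C (γ t))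
  have hδ : ContDiff ℝ ∞ δ := by fun_prop
  have hδ' : HasDerivAt δ (deriv δ 0) 0 :=
    (hδ.contDiffAt.differentiableAt (by simp)).hasDerivAt
  refine ⟨deriv δ 0, fun t => (δ t, γ t), (hδ.prodMk hγ).contDiffAt, ?_, .of_forall fun t => ?_,
    hδ'.prodMk hγ'⟩
  · simp only at h4
    simp [δ, hγ0, h4]
  · obtain ⟨g1, g2⟩ := (mem_cylinder_iff C hm _).1 (hγZ t)
    rw [mem_poincareSurface_iff C hm]
    simp only at h3
    simp [δ, g1, g2, h3, massInvL_massMulL hm, weightedSum_posIL C hm]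

/-- The fibre vector with velocity part `δq` yields `|δq|² = 0`. Once `δq = 0`, the derivative of
`⟨q^I, v⟩ = 0` says that `δv` is tangent to `Z`; pairing with a lift of `δv` then yields `|δv|² =
0`. -/
theorem canonicalForm_nondegenerate (hm : ∀ i, 0 < m i) {x : Phase d n}
    (hx : x ∈ poincareSurface m C) {u : Phase d n}
    (hu : u ∈ tangentSpaceAt (poincareSurface m C) x)
    (h : ∀ v ∈ tangentSpaceAt (poincareSurface m C) x, canonicalForm u v = 0) : u = 0 := by
  let fs := ContinuousLinearMap.fst ℝ (Vec d n) (Vec d n)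
  let sn := ContinuousLinearMap.snd ℝ (Vec d n) (Vec d n)
  have hS := fun (y : Phase d n) (hy : y ∈ poincareSurface m C) =>
    (mem_poincareSurface_iff C hm y).1 hy
  have h1 : weightedSum m u.2 = 0 :=
    map_tangent_eq_zero (f' := (weightedSum m).comp sn)
      ((weightedSum m).comp sn).hasFDerivAt
    (fun y hy => (hS y hy).1) hu
  have h2 : weightedSum m (massInvL m u.1) = 0 :=
    map_tangent_eq_zero (f' := (weightedSum m).comp ((massInvL m).comp fs))
      ((weightedSum m).comp ((massInvL m).comp fs)).hasFDerivAt
      (fun y hy => (hS y hy).2.2.1) hu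
  have h3 : massForm m (posIL m C x.2) u.2 = 0 := by
    obtain ⟨f', hf', hf'w⟩ := exists_hasFDerivAt_massForm m ((posIL m C).comp sn)
      ((posIL m C).comp sn) x
    have := map_tangent_eq_zero (hf'.sub_const 1)
      (fun y hy => sub_eq_zero.2 (hS y hy).2.1) hu
    rw [hf'w, massForm_comm m (((posIL m C).comp sn) u)] at this
    rw [massForm_posIL_left C hm]
    change massForm m (posIL m C x.2) (posIL m C u.2) +
      massForm m (posIL m C x.2) (posIL m C u.2) = 0 at this
    linarith
  have hq : u.2 = 0 := by
    have := h _ (vertical_mem_tangentSpaceAt C hm hx h1 h3)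
    rw [canonicalForm_eq hm] at this
    simp only [massInvL_massMulL hm, map_zero, sub_zero] at this
    exact massForm_self_eq_zero hm this
  have h4 : massForm m (posIL m C x.2) (massInvL m u.1) = 0 := by
    obtain ⟨f', hf', hf'w⟩ := exists_hasFDerivAt_massForm m ((posIL m C).comp sn)
      ((massInvL m).comp fs) x
    have := map_tangent_eq_zero hf' (fun y hy => (hS y hy).2.2.2) hu
    simpa [hf'w, fs, sn, hq] using this
  obtain ⟨a, ha⟩ := exists_lift_mem_tangentSpaceAt C hm hx h2 h4
  have := h _ ha
  rw [canonicalForm_eq hm, hq, map_zero, zero_sub, neg_eq_zero] at this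
  have hp := massForm_self_eq_zero hm this
  refine Prod.ext ?_ hq
  rw [← massMulL_massInvL hm u.1, hp, map_zero]
  rfl

theorem omegaMinus_apply (u v : Phase d n × Phase d n) :
    omegaMinus u v = canonicalForm u.1 v.1 - canonicalForm u.2 v.2 := rfl

theorem isSymplecticSubmanifold_poincareSurface_prod (hm : ∀ i, 0 < m i) (hd : 0 < d)
    (hn : 2 ≤ n) : IsSymplecticSubmanifold (omegaMinus (d := d) (n := n))
      (poincareSurface m C ×ˢ poincareSurface m C) where
  alt u := by
    rw [omegaMinus_apply, canonicalForm_eq hm, canonicalForm_eq hm]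
    simp
  submanifold := ⟨_, (isEmbeddedSubmanifold_poincareSurface C hm hd hn).prod
    (isEmbeddedSubmanifold_poincareSurface C hm hd hn)⟩
  nondegenerate := by
    rintro ⟨x, y⟩ ⟨hx, hy⟩ ⟨a, b⟩ hu h
    have ha : a = 0 := canonicalForm_nondegenerate C hm hx
      (fst_mem_tangentSpaceAt hu) fun v hv => by
      have := h _ (mk_mem_tangentSpaceAt_prod_left hy hv)
      simpa [omegaMinus_apply] using this
    have hb : b = 0 := canonicalForm_nondegenerate C hm hy
      (snd_mem_tangentSpaceAt hu) fun v hv => by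
      have := h _ (mk_mem_tangentSpaceAt_prod_right hx hv)
      simpa [omegaMinus_apply] using this
    rw [ha, hb]
    rfl

end PoincareSurface

/-! ### The relation `L`: equations, dimension and isotropy -/

section LagrangianRelation

variable {d n : ℕ} {m : Fin n → ℝ} (C : SetPartition n)

/-- The sum of the inverse speeds at external kinetic energy `k`. -/
def inverseSpeedSum (Em Ep k : ℝ) : ℝ := (√(2 * (Ep - k)))⁻¹ + (√(2 * (Em - k)))⁻¹

theorem contDiffAt_inverseSpeedSum {Em Ep k : ℝ} (hk : k < min Em Ep) :
    ContDiffAt ℝ ∞ (inverseSpeedSum Em Ep) k := by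
  have key : ∀ e : ℝ, k < e → ContDiffAt ℝ ∞ (fun k => (√(2 * (e - k)))⁻¹) k := fun e he => by
    have h0 : 0 < 2 * (e - k) := by linarith
    have h1 : ContDiffAt ℝ ∞ (fun k => 2 * (e - k)) k := by fun_prop
    exact (h1.sqrt h0.ne').inv (Real.sqrt_pos.2 h0).ne'
  obtain ⟨h1, h2⟩ := lt_min_iff.1 hk
  exact (key Ep h2).add (key Em h1)

/-- The external kinetic energy as a function of the velocity. -/
def externalEnergy (m : Fin n → ℝ) (C : SetPartition n) (v : Vec d n) : ℝ :=
  massForm m (posEL m C v) (posEL m C v) / 2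

/-- The displacement `(q₊)^E - (q₋)^E` as a function of the velocity. -/
def displacement (m : Fin n → ℝ) (C : SetPartition n) (Em Ep : ℝ) (v : Vec d n) : Vec d n :=
  inverseSpeedSum Em Ep (externalEnergy m C v) • posEL m C v

theorem contDiff_externalEnergy : ContDiff ℝ ∞ (externalEnergy (d := d) m C) :=
  (contDiff_massForm m _ _).div_const 2

theorem contDiffAt_displacement {Em Ep : ℝ} {v : Vec d n}
    (hv : externalEnergy m C v < min Em Ep) : ContDiffAt ℝ ∞ (displacement m C Em Ep) v :=
  ((contDiffAt_inverseSpeedSum hv).comp v (contDiff_externalEnergy C).contDiffAt).smul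
    (posEL m C).contDiff.contDiffAt

/-- Only the shape of `D` matters later, not the values of `a` and `b`: a multiple of the projection
plus a symmetric rank-one term. Hence `D` is self-adjoint and takes external values. -/
theorem exists_hasFDerivAt_displacement (hm : ∀ i, 0 < m i) {Em Ep : ℝ} {v : Vec d n}
    (hv : externalEnergy m C v < min Em Ep) :
    ∃ (D : Vec d n →L[ℝ] Vec d n) (a b : ℝ), HasFDerivAt (displacement m C Em Ep) D v ∧
      ∀ w, D w = a • posEL m C w + (b * massForm m (posEL m C v) w) • posEL m C v := by
  obtain ⟨f', hf', hf'w⟩ := exists_hasFDerivAt_massForm m (posEL m C) (posEL m C) v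
  have h1 : HasFDerivAt (externalEnergy m C) ((2 : ℝ)⁻¹ • f') v := by
    have := hf'.const_smul (2 : ℝ)⁻¹
    refine this.congr_of_eventuallyEq (.of_forall fun y => ?_)
    simp [externalEnergy, div_eq_inv_mul]
  have h2 := ((contDiffAt_inverseSpeedSum hv).differentiableAt (by simp)).hasDerivAt
  refine ⟨_, inverseSpeedSum Em Ep (externalEnergy m C v),
    deriv (inverseSpeedSum Em Ep) (externalEnergy m C v),
    (h2.comp_hasFDerivAt v h1).smul (posEL m C).hasFDerivAt, fun w => ?_⟩
  have h3 : f' w = 2 * massForm m (posEL m C v) w := by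
    rw [hf'w, massForm_comm m (posEL m C w), ← massForm_posEL_left C hm]
    ring
  simp [h3]

/-- The defining equations of the relation. -/
def relationMap (m : Fin n → ℝ) (C : SetPartition n) (Em Ep : ℝ) (x : Phase d n × Phase d n) :
    Vec d n × Vec d n × EuclideanSpace ℝ (Fin d) × EuclideanSpace ℝ (Fin d) × ℝ × ℝ :=
  (x.2.1 - x.1.1,
    posIL m C (massInvL m x.1.1) + posEL m C (x.2.2 - x.1.2) -
      displacement m C Em Ep (massInvL m x.1.1),
    weightedSum m (massInvL m x.1.1), weightedSum m x.1.2,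
    massForm m (posIL m C x.1.2) (posIL m C x.1.2) - 1,
    massForm m (posIL m C x.2.2) (posIL m C x.2.2) - 1)

theorem posIL_displacement (hm : ∀ i, 0 < m i) (Em Ep : ℝ) (v : Vec d n) :
    posIL m C (displacement m C Em Ep v) = 0 := by
  rw [displacement, map_smul, posIL_posEL C hm, smul_zero]

/-- The internal and the external condition lie in complementary subspaces, so their sum encodes
both. Merging them in `relationMap` avoids redundant components, which would destroy surjectivity of
its derivative. -/
theorem posIL_add_posEL_sub_eq_zero_iff (hm : ∀ i, 0 < m i) {a b c : Vec d n}
    (hc : posIL m C c = 0) :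
    posIL m C a + posEL m C b - c = 0 ↔ posIL m C a = 0 ∧ posEL m C b = c := by
  constructor
  · intro h
    have h1 : posIL m C a = 0 := by
      have := congrArg (posIL m C) h
      simpa [posIL_posIL C hm, posIL_posEL C hm, hc] using this
    rw [h1, zero_add, sub_eq_zero] at h
    exact ⟨h1, h⟩
  · rintro ⟨h1, h2⟩
    rw [h1, h2, zero_add, sub_self]

/-- Both momenta equal their common external part, so they coincide. Some conditions for membership
in `P × P` are then automatic and are left out of `relationMap`: an external velocity is orthogonal
to every internal vector, and the center of mass condition on `q₊` follows from the others. -/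
theorem mem_lagrangianRelation_iff (hm : ∀ i, 0 < m i) (Em Ep : ℝ) (x : Phase d n × Phase d n) :
    x ∈ lagrangianRelation m C Em Ep ↔
      externalEnergy m C (massInvL m x.1.1) < min Em Ep ∧ relationMap m C Em Ep x = 0 := by
  have hK : ∀ p : Vec d n, kineticE m C p = externalEnergy m C (massInvL m p) := kineticE_eq C hm
  have hrel : ∀ (p q q' : Vec d n), (posE m C q' -
      (√(2 * (Ep - kineticE m C p)))⁻¹ • posE m C (massInv m p) = posE m C q +
      (√(2 * (Em - kineticE m C p)))⁻¹ • posE m C (massInv m p)) ↔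
      posEL m C (q' - q) = displacement m C Em Ep (massInvL m p) := fun p q q' => by
    rw [displacement, inverseSpeedSum, add_smul, map_sub, sub_eq_iff_eq_add, sub_eq_iff_eq_add,
      hK]
    simp only [posEL_apply, massInvL_apply]
    rw [add_comm (posE m C q), add_right_comm, add_comm ((√(2 * (Em - _)))⁻¹ • _)]
  constructor
  · rintro ⟨p, q, p', q', rfl, hP, hP', hI, hI', hE, hKm, -, h⟩
    obtain rfl : p' = p := by
      rw [momI, sub_eq_zero] at hI hI'
      rw [hI, hI', hE]
    rw [mem_poincareSurface_iff C hm] at hP hP'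
    obtain ⟨h1, h2, h3, -⟩ := hP
    obtain ⟨h1', h2', -, -⟩ := hP'
    simp only at h1 h2 h3 h2'
    refine ⟨(hK p').symm.trans_lt hKm, ?_⟩
    have h4 := (posIL_add_posEL_sub_eq_zero_iff C hm (posIL_displacement C hm Em Ep _)).2
      ⟨(momI_eq_zero_iff C hm p').1 hI, (hrel p' q q').1 h⟩
    simp only [relationMap, h1, h2, h3, h2', h4, sub_self]
    rfl
  · obtain ⟨⟨p, q⟩, ⟨p', q'⟩⟩ := x
    rintro ⟨hE, h⟩
    simp only [relationMap, Prod.mk_eq_zero, sub_eq_zero (a := p'), sub_eq_zero (b := (1 : ℝ))]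
      at h hE
    obtain ⟨rfl, h2, h3, h4, h5, h6⟩ := h
    obtain ⟨hI, hD⟩ := (posIL_add_posEL_sub_eq_zero_iff C hm
      (posIL_displacement C hm Em Ep _)).1 h2
    -- The displacement is a multiple of `v^E`, whose weighted sum is that of `v`, namely zero; so
    -- `q₊` and `q₋` have the same weighted sum.
    have hq' : weightedSum m q' = 0 := by
      have := congrArg (weightedSum m) hD
      rw [weightedSum_posEL C hm, displacement, map_smul, weightedSum_posEL C hm, h3, smul_zero,
        map_sub, h4, sub_zero] at this
      exact this
    have hz : ∀ r, massForm m (posIL m C r) (massInvL m p') = 0 := fun r => by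
      rw [massForm_posIL_left C hm, hI, map_zero]
    have hI' := (momI_eq_zero_iff C hm p').2 hI
    rw [← hK] at hE
    exact ⟨p', q, p', q', rfl, (mem_poincareSurface_iff C hm _).2 ⟨h4, h5, h3, hz _⟩,
      (mem_poincareSurface_iff C hm _).2 ⟨hq', h6, h3, hz _⟩, hI', hI', rfl, hE, hE,
      (hrel p' q q').2 hD⟩

theorem isOpen_externalEnergy_lt (e : ℝ) :
    IsOpen {x : Phase d n × Phase d n | externalEnergy m C (massInvL m x.1.1) < e} :=
  isOpen_lt ((contDiff_externalEnergy C).continuous.comp (by fun_prop)) continuous_const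

theorem contDiffOn_relationMap (Em Ep : ℝ) : ContDiffOn ℝ ∞ (relationMap (d := d) m C Em Ep)
    {x | externalEnergy m C (massInvL m x.1.1) < min Em Ep} := by
  intro x hx
  have h : ContDiffAt ℝ ∞ (fun x : Phase d n × Phase d n =>
      displacement m C Em Ep (massInvL m x.1.1)) x :=
    ContDiffAt.comp x (g := displacement m C Em Ep)
      (f := fun x : Phase d n × Phase d n => massInvL m x.1.1)
      (contDiffAt_displacement C hx) (by fun_prop)
  refine ContDiffAt.contDiffWithinAt ?_
  unfold relationMap
  fun_prop

/-- The derivative of `relationMap`, with `D` the derivative of `displacement`. -/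
theorem exists_hasFDerivAt_relationMap {Em Ep : ℝ} {x : Phase d n × Phase d n}
    {D : Vec d n →L[ℝ] Vec d n}
    (hD : HasFDerivAt (displacement m C Em Ep) D (massInvL m x.1.1)) :
    ∃ f' : (Phase d n × Phase d n) →L[ℝ] (Vec d n × Vec d n × EuclideanSpace ℝ (Fin d) ×
      EuclideanSpace ℝ (Fin d) × ℝ × ℝ), HasFDerivAt (relationMap m C Em Ep) f' x ∧
      ∀ u, f' u = (u.2.1 - u.1.1,
      posIL m C (massInvL m u.1.1) + posEL m C (u.2.2 - u.1.2) - D (massInvL m u.1.1),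
      weightedSum m (massInvL m u.1.1), weightedSum m u.1.2,
      2 * massForm m (posIL m C x.1.2) (posIL m C u.1.2),
      2 * massForm m (posIL m C x.2.2) (posIL m C u.2.2)) := by
  let X := Phase d n × Phase d n
  let pm : X →L[ℝ] Vec d n := (ContinuousLinearMap.fst ℝ _ _).comp (ContinuousLinearMap.fst ℝ _ _)
  let qm : X →L[ℝ] Vec d n := (ContinuousLinearMap.snd ℝ _ _).comp (ContinuousLinearMap.fst ℝ _ _)
  let pp : X →L[ℝ] Vec d n := (ContinuousLinearMap.fst ℝ _ _).comp (ContinuousLinearMap.snd ℝ _ _)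
  let qp : X →L[ℝ] Vec d n := (ContinuousLinearMap.snd ℝ _ _).comp (ContinuousLinearMap.snd ℝ _ _)
  let vm : X →L[ℝ] Vec d n := (massInvL m).comp pm
  obtain ⟨f1, hf1, hf1w⟩ := exists_hasFDerivAt_massForm m ((posIL m C).comp qm)
    ((posIL m C).comp qm) x
  obtain ⟨f2, hf2, hf2w⟩ := exists_hasFDerivAt_massForm m ((posIL m C).comp qp)
    ((posIL m C).comp qp) x
  have hD' : HasFDerivAt (fun x : X => displacement m C Em Ep (vm x)) (D.comp vm) x :=
    HasFDerivAt.comp x (g := displacement m C Em Ep) hD vm.hasFDerivAt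
  have h := (pp - pm).hasFDerivAt (x := x) |>.prodMk <|
    (((posIL m C).comp vm + (posEL m C).comp (qp - qm)).hasFDerivAt.sub hD').prodMk <|
    ((weightedSum m).comp vm).hasFDerivAt.prodMk <| ((weightedSum m).comp qm).hasFDerivAt.prodMk <|
    (hf1.sub_const 1).prodMk (hf2.sub_const 1)
  refine ⟨_, h, fun u => ?_⟩
  simp only [ContinuousLinearMap.prod_apply, hf1w, hf2w]
  rw [massForm_comm m (((posIL m C).comp qm) u), massForm_comm m (((posIL m C).comp qp) u),
    ← two_mul, ← two_mul]
  rfl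

theorem isEmbeddedSubmanifold_lagrangianRelation (hm : ∀ i, 0 < m i) (hd : 0 < d) (hn : 2 ≤ n)
    (Em Ep : ℝ) : IsEmbeddedSubmanifold (2 * (n * d - d - 1))
      (lagrangianRelation (d := d) m C Em Ep) := by
  have hnd : 2 * d ≤ n * d := Nat.mul_le_mul_right d hn
  refine .of_submersion (Vec d n × Vec d n × EuclideanSpace ℝ (Fin d) ×
    EuclideanSpace ℝ (Fin d) × ℝ × ℝ) ?_ fun x hx => ?_
  · rw [Module.finrank_prod (M := Phase d n), finrank_phase]
    simp only [Module.finrank_prod, finrank_vec, finrank_euclideanSpace, Fintype.card_fin,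
      Module.finrank_self]
    omega
  obtain ⟨hE, hx0⟩ := (mem_lagrangianRelation_iff C hm Em Ep x).1 hx
  obtain ⟨D, a, b, hD, hDw⟩ := exists_hasFDerivAt_displacement C hm hE
  obtain ⟨f', hf', hf'w⟩ := exists_hasFDerivAt_relationMap C hD
  refine ⟨_, relationMap m C Em Ep, f', isOpen_externalEnergy_lt C (min Em Ep), hE,
    contDiffOn_relationMap C Em Ep, fun y hy => ?_, hf', ?_⟩
  · exact (mem_lagrangianRelation_iff C hm Em Ep y).trans (and_iff_right hy)
  · rintro ⟨y₁, y₂, s, t, α, β⟩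
    obtain ⟨s', hs⟩ := exists_constVec hm (by omega) s
    obtain ⟨t', ht⟩ := exists_constVec hm (by omega) t
    simp only [relationMap, Prod.mk_eq_zero, sub_eq_zero (b := (1 : ℝ))] at hx0
    obtain ⟨-, -, -, -, h1, h2⟩ := hx0
    set v := posIL m C y₂ + constVec n s' with hv
    set w := constVec n t' + (α / 2) • posIL m C x.1.2 with hw
    -- The velocity `v` supplies the internal part of `y₂` and the weighted sum `s`, and `w`
    -- supplies `t` and `α`. The external part of `δq₊` supplies that of `y₂` after compensating for
    -- `w` and `D v`, while its internal part, a multiple of `(q₊)^I`, supplies `β`.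
    refine ⟨((massMulL m v, w), (massMulL m v + y₁,
      posEL m C (y₂ + w) + D v + (β / 2) • posIL m C x.2.2)), ?_⟩
    have hDE : posEL m C (D v) = D v := by simp [hDw, posEL_posEL C hm]
    have hDI : posIL m C (D v) = 0 := by rw [← hDE, posIL_posEL C hm]
    have hIv : posIL m C v = posIL m C y₂ := by
      rw [hv, map_add, posIL_posIL C hm, posIL_constVec C hm, add_zero]
    rw [hf'w]
    simp only [massInvL_massMulL hm]
    refine Prod.ext (add_sub_cancel_left _ _) (Prod.ext ?_ (Prod.ext ?_ (Prod.ext ?_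
      (Prod.ext ?_ ?_))))
    · simp only [map_add, map_sub, map_smul, posEL_posEL C hm, posEL_posIL C hm, hDE, hIv,
        smul_zero, add_zero]
      conv_rhs => rw [← posEL_add_posIL C (m := m) y₂]
      abel
    · simp [hv, weightedSum_posIL C hm, hs]
    · simp [hw, weightedSum_posIL C hm, ht]
    · simp [hw, posIL_constVec C hm, posIL_posIL C hm, h1, mul_div_cancel₀]
    · simp [posIL_posEL C hm, posIL_posIL C hm, h2, hDI, mul_div_cancel₀]

/-- Tangent vectors have `δp₊ = δp₋`, external `δv`, and `(δq₊ - δq₋)^E = D δv`. Thus `ω_⊖` of two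
of them is `⟨δv, D δv'⟩ - ⟨δv', D δv⟩`, which vanishes by self-adjointness of `D`. -/
theorem omegaMinus_eq_zero_of_mem_tangentSpaceAt (hm : ∀ i, 0 < m i) {Em Ep : ℝ}
    {x u v : Phase d n × Phase d n} (hx : x ∈ lagrangianRelation m C Em Ep)
    (hu : u ∈ tangentSpaceAt (lagrangianRelation m C Em Ep) x)
    (hv : v ∈ tangentSpaceAt (lagrangianRelation m C Em Ep) x) : omegaMinus u v = 0 := by
  obtain ⟨hE, -⟩ := (mem_lagrangianRelation_iff C hm Em Ep x).1 hx
  obtain ⟨D, a, b, hD, hDw⟩ := exists_hasFDerivAt_displacement C hm hE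
  obtain ⟨f', hf', hf'w⟩ := exists_hasFDerivAt_relationMap C hD
  have key : ∀ w ∈ tangentSpaceAt (lagrangianRelation m C Em Ep) x, w.2.1 = w.1.1 ∧
      posEL m C (massInvL m w.1.1) = massInvL m w.1.1 ∧
      posEL m C (w.2.2 - w.1.2) = D (massInvL m w.1.1) := fun w hw => by
    have h := map_tangent_eq_zero hf'
      (fun y hy => ((mem_lagrangianRelation_iff C hm Em Ep y).1 hy).2) hw
    simp only [hf'w, Prod.mk_eq_zero, sub_eq_zero (a := w.2.1)] at h
    have hI := (posIL_add_posEL_sub_eq_zero_iff C hm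
      (by simp [hDw, posIL_posEL C hm])).1 h.2.1
    refine ⟨h.1, ?_, hI.2⟩
    conv_rhs => rw [← posEL_add_posIL C (m := m) (massInvL m w.1.1), hI.1, add_zero]
  obtain ⟨hu1, hu2, hu3⟩ := key u hu
  obtain ⟨hv1, hv2, hv3⟩ := key v hv
  have hsymm : massForm m (massInvL m v.1.1) (D (massInvL m u.1.1)) =
      massForm m (massInvL m u.1.1) (D (massInvL m v.1.1)) := by
    simp only [hDw, hu2, hv2, map_add, map_smul, smul_eq_mul]
    rw [massForm_comm m (massInvL m v.1.1) (massInvL m u.1.1), massForm_comm m (massInvL m v.1.1),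
      massForm_comm m (massInvL m u.1.1) (posEL m C _)]
    ring
  -- The projection moves from `δq₊ - δq₋` onto the velocities, which it fixes; so the internal
  -- parts of `δq₊` and `δq₋` do not contribute.
  rw [← hu3, ← hv3, ← massForm_posEL_comm C hm, ← massForm_posEL_comm C hm, hu2, hv2, map_sub,
    map_sub] at hsymm
  rw [omegaMinus_apply, canonicalForm_eq hm, canonicalForm_eq hm, hu1, hv1]
  linarith

end LagrangianRelation

end ClusterScattering

end

theorem lemma4p1 {d n : ℕ} (hd : 0 < d) (m : Fin n → ℝ) (hm : ∀ i, 0 < m i)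
    (C : ClusterScattering.SetPartition n) (hC : C ≠ ⊥)
    (Em Ep : ℝ) (hEm : 0 < Em) (hEp : 0 < Ep) :
    ClusterScattering.IsLagrangianSubmanifold
      (ClusterScattering.omegaMinus (d := d) (n := n))
      (ClusterScattering.poincareSurface m C ×ˢ ClusterScattering.poincareSurface m C)
      (ClusterScattering.lagrangianRelation m C Em Ep) := by
  have hn := ClusterScattering.two_le_of_ne_bot hC
  have hP := ClusterScattering.isEmbeddedSubmanifold_poincareSurface C hm hd hn
  refine ⟨ClusterScattering.isSymplecticSubmanifold_poincareSurface_prod C hm hd hn, ?_,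
    ⟨_, ?_, ClusterScattering.isEmbeddedSubmanifold_lagrangianRelation C hm hd hn Em Ep⟩,
    fun x hx u hu v hv =>
      ClusterScattering.omegaMinus_eq_zero_of_mem_tangentSpaceAt C hm hx hu hv⟩
  · rintro _ ⟨p, q, p', q', rfl, h, h', -⟩
    exact ⟨h, h'⟩
  -- Here `k = dim P = dim L`, so the required dimension `2 * k` of the ambient manifold is that of
  -- `P × P`.
  · rw [two_mul]
    exact hP.prod hP
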